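/- Let $n\ge 1$, let $\mathbb F_n^+$ be the free semigroup with unit on generators $g_1,\dots,g_n$, and let $|\alpha|$ be the length of a word $\alpha$. For an $n$-tuple $X=(X_1,\dots,X_n)$ of elements of a unital algebra and $\alpha=g_{i_1}\cdots g_{i_k}$ write $X_\alpha=X_{i_1}\cdots X_{i_k}$, with $X_\alpha=1$ for the empty word. Let $p=\sum_{1\le|\alpha|\le N}a_\alpha X_\alpha$ be a positive regular noncommutative polynomial, i.e. $a_\alpha\ge 0$ for all $\alpha$ and $a_{g_i}>0$ for $i=1,\dots,n$. Put $b_\alpha=1$ for the empty word, and for $|\alpha|\ge1$ $$b_\alpha=\sum_{j=1}^{|\alpha|}\ \sum_{\gamma_1\cdots\gamma_j=\alpha,\ |\gamma_i|\ge1}a_{\gamma_1}\cdots a_{\gamma_j}.$$ Let $W_1,\dots,W_n$ be the weighted left creation operators on the full Fock space $F^2(H_n)$ with orthonormal basis $(e_\alpha)_{\alpha\in\mathbb F_n^+}$, given by $W_ie_\alpha=\sqrt{b_\alpha/b_{g_i\alpha}}\;e_{g_i\alpha}$. Let $Hol(\mathcal D_p)$ be the algebra of free holomorphic functions on $\mathcal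 D_p$: all formal power series $g=\sum_{\alpha}c_\alpha Z_\alpha$, $c_\alpha\in\mathbb C$, in noncommuting indeterminates $Z_1,\dots,Z_n$ such that $g(rW_1,\dots,rW_n):=\sum_{k=0}^\infty\sum_{|\alpha|=k}c_\alpha r^{|\alpha|}W_\alpha$ converges in operator norm for every $r\in[0,1)$. Let $0<r_m<1$ be an increasing sequence with $r_m\to1$, and equip $Hol(\mathcal D_p)$ with the metric $$\rho(\varphi,\psi)=\sum_{m=1}^\infty 2^{-m}\frac{d_{r_m}(\varphi,\psi)}{1+d_{r_m}(\varphi,\psi)},\qquad d_r(\varphi,\psi)=\|\varphi(rW_1,\dots,rW_n)-\psi(rW_1,\dots,rW_n)\|.$$ Let $\mathcal H$ be a complex Hilbert space and $T=(T_1,\dots,T_n)\in B(\mathcal H)^n$ with joint spectral radius $$r_p(T):=\lim_{m\to\infty}\|\Phi_{p,T}^m(I)\|^{1/2m}<1,\qquad \Phi_{p,T}(X)=\sum_{1\le|\alpha|\le N}a_\alpha T_\alpha XT_\alpha^*.$$ Then for every $g=\sum_\alpha c_\alpha Z_\alpha\in Hol(\mathcal D_p)$ the series $g(T_1,\dots,T_n):=\sum_{k=0}^\infty\sum_{|\alpha|=k}c_\alpha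 T_\alpha$ converges in the operator norm of $B(\mathcal H)$, and the map $\Psi_{p,T}:Hol(\mathcal D_p)\to B(\mathcal H)$, $\Psi_{p,T}(g):=g(T_1,\dots,T_n)$, is a unital algebra homomorphism with $\Psi_{p,T}(Z_i)=T_i$ for all $i$, continuous from $(Hol(\mathcal D_p),\rho)$ to $B(\mathcal H)$ with the operator norm. Moreover, $\Psi_{p,T}$ is the only continuous unital algebra homomorphism $\Phi:(Hol(\mathcal D_p),\rho)\to B(\mathcal H)$ with $\Phi(Z_i)=T_i$ for $i=1,\dots,n$. -/

import Mathlib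

open scoped Topology

noncomputable section

namespace FreeHol

/-! ### Words and formal power series in noncommuting indeterminates -/

/-- The free semigroup with unit on `n` generators `g_1, …, g_n`. -/
abbrev Word (n : ℕ) : Type := FreeMonoid (Fin n)

/-- The finite set of words of length `k`. -/
def words (n k : ℕ) : Finset (Word n) :=
  Finset.univ.map
    ⟨fun v : Fin k → Fin n => FreeMonoid.ofList (List.ofFn v), fun _ _ h =>
      List.ofFn_injective (FreeMonoid.ofList.injective h)⟩

theorem mem_words {n k : ℕ} {w : Word n} : w ∈ words n k ↔ w.length = k := by
  simp only [words, Finset.mem_map, Finset.mem_univ, true_and]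
  constructor
  · rintro ⟨v, rfl⟩
    exact List.length_ofFn
  · rintro rfl
    exact ⟨fun i => w.toList.get i, List.ofFn_get _⟩

open Classical in
/-- The finite set of all factorizations `w = u v` of a word. -/
def splits {n : ℕ} (w : Word n) : Finset (Word n × Word n) :=
  (Finset.range (w.length + 1)).image fun i =>
    (FreeMonoid.ofList (w.toList.take i), FreeMonoid.ofList (w.toList.drop i))

theorem mem_splits {n : ℕ} {w : Word n} {x : Word n × Word n} :
    x ∈ splits w ↔ x.1 * x.2 = w := by
  simp only [splits, Finset.mem_image, Finset.mem_range]
  constructor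
  · rintro ⟨i, -, rfl⟩
    exact List.take_append_drop i w.toList
  · rintro rfl
    obtain ⟨u, v⟩ := x
    refine ⟨u.length, ?_, ?_⟩
    · simp only [FreeMonoid.length_mul]
      omega
    · refine Prod.ext ?_ ?_
      · exact List.take_left (l₁ := u.toList) (l₂ := v.toList)
      · exact List.drop_left (l₁ := u.toList) (l₂ := v.toList)

/-- Formal power series `∑ c_α Z_α` with complex coefficients in the noncommuting
indeterminates `Z_1, …, Z_n`, given by their coefficients. -/
def FormalSeries (n : ℕ) : Type := Word n → ℂ

namespace FormalSeries

variable {n : ℕ}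

instance : AddCommGroup (FormalSeries n) := inferInstanceAs (AddCommGroup (Word n → ℂ))

instance : Module ℂ (FormalSeries n) := inferInstanceAs (Module ℂ (Word n → ℂ))

open Classical in
/-- The monomial `Z_α`. -/
def monomial (α : Word n) : FormalSeries n := fun w => if w = α then 1 else 0

instance : One (FormalSeries n) := ⟨monomial 1⟩

/-- The product of formal power series, determined by `Z_α Z_β = Z_{αβ}`. -/
instance : Mul (FormalSeries n) := ⟨fun c d => fun w => ∑ x ∈ splits w, c x.1 * d x.2⟩

theorem mul_apply (c d : FormalSeries n) (w : Word n) :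
    (c * d) w = ∑ x ∈ splits w, c x.1 * d x.2 := rfl

theorem one_apply_one : (1 : FormalSeries n) 1 = 1 := by
  classical
  exact if_pos rfl

theorem one_apply_of_ne {w : Word n} (h : w ≠ 1) : (1 : FormalSeries n) w = 0 := by
  classical
  exact if_neg h

theorem add_apply (c d : FormalSeries n) (w : Word n) : (c + d) w = c w + d w := rfl

theorem smul_apply (a : ℂ) (c : FormalSeries n) (w : Word n) : (a • c) w = a * c w := rfl

theorem zero_apply (w : Word n) : (0 : FormalSeries n) w = 0 := rfl

protected theorem one_mul (c : FormalSeries n) : 1 * c = c := by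
  funext w
  rw [mul_apply, Finset.sum_eq_single (1, w)]
  · rw [one_apply_one, _root_.one_mul]
  · rintro ⟨u, v⟩ hx hne
    have hu : u ≠ 1 := by
      rintro rfl
      exact hne (by simpa [mem_splits] using hx)
    rw [one_apply_of_ne hu, zero_mul]
  · intro h
    exact absurd (mem_splits.2 (_root_.one_mul w)) h

protected theorem mul_one (c : FormalSeries n) : c * 1 = c := by
  funext w
  rw [mul_apply, Finset.sum_eq_single (w, 1)]
  · rw [one_apply_one, _root_.mul_one]
  · rintro ⟨u, v⟩ hx hne
    have hv : v ≠ 1 := by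
      rintro rfl
      exact hne (by simpa [mem_splits] using hx)
    rw [one_apply_of_ne hv, mul_zero]
  · intro h
    exact absurd (mem_splits.2 (_root_.mul_one w)) h

protected theorem mul_assoc (a b c : FormalSeries n) : a * b * c = a * (b * c) := by
  funext w
  simp only [mul_apply, Finset.sum_mul, Finset.mul_sum]
  rw [Finset.sum_sigma', Finset.sum_sigma']
  refine Finset.sum_bij' (fun x _ => ⟨(x.2.1, x.2.2 * x.1.2), (x.2.2, x.1.2)⟩)
    (fun x _ => ⟨(x.1.1 * x.2.1, x.2.2), (x.1.1, x.2.1)⟩) ?_ ?_ ?_ ?_ ?_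
  · rintro ⟨⟨u, v⟩, ⟨s, t⟩⟩ h
    simp only [Finset.mem_sigma, mem_splits] at h ⊢
    exact ⟨by rw [← _root_.mul_assoc, h.2, h.1], trivial⟩
  · rintro ⟨⟨u, v⟩, ⟨s, t⟩⟩ h
    simp only [Finset.mem_sigma, mem_splits] at h ⊢
    exact ⟨by rw [_root_.mul_assoc, h.2, h.1], trivial⟩
  · rintro ⟨⟨u, v⟩, ⟨s, t⟩⟩ h
    simp only [Finset.mem_sigma, mem_splits] at h
    obtain ⟨-, rfl⟩ := h
    rfl
  · rintro ⟨⟨u, v⟩, ⟨s, t⟩⟩ h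
    simp only [Finset.mem_sigma, mem_splits] at h
    obtain ⟨-, rfl⟩ := h
    rfl
  · rintro ⟨⟨u, v⟩, ⟨s, t⟩⟩ -
    exact _root_.mul_assoc _ _ _

instance : Ring (FormalSeries n) :=
  { (inferInstance : AddCommGroup (FormalSeries n)) with
    mul := (· * ·)
    one := 1
    one_mul := FormalSeries.one_mul
    mul_one := FormalSeries.mul_one
    mul_assoc := FormalSeries.mul_assoc
    zero_mul := fun c => by
      funext w
      simp only [mul_apply, zero_apply, zero_mul, Finset.sum_const_zero]
    mul_zero := fun c => by
      funext w
      simp only [mul_apply, zero_apply, mul_zero, Finset.sum_const_zero]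
    left_distrib := fun a b c => by
      funext w
      simp only [mul_apply, add_apply, mul_add, Finset.sum_add_distrib]
    right_distrib := fun a b c => by
      funext w
      simp only [mul_apply, add_apply, add_mul, Finset.sum_add_distrib] }

instance : Algebra ℂ (FormalSeries n) :=
  Algebra.ofModule
    (fun r x y => by
      funext w
      simp only [mul_apply, smul_apply, Finset.mul_sum, _root_.mul_assoc])
    (fun r x y => by
      funext w
      simp only [mul_apply, smul_apply, Finset.mul_sum]
      exact Finset.sum_congr rfl fun _ _ => mul_left_comm _ _ _)

end FormalSeries

/-! ### Evaluation of formal power series at tuples -/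

section Evaluation

variable {n : ℕ} {A : Type*} [NormedRing A] [NormedAlgebra ℂ A]

/-- `X_α = X_{i_1} ⋯ X_{i_k}` for `α = g_{i_1} ⋯ g_{i_k}`, and `X_α = 1` for the empty word. -/
def wordProd (X : Fin n → A) (α : Word n) : A := FreeMonoid.lift X α

/-- The homogeneous part `∑_{|α| = k} c_α X_α`. -/
def homPart (X : Fin n → A) (c : FormalSeries n) (k : ℕ) : A :=
  ∑ α ∈ words n k, c α • wordProd X α

/-- The partial sum `∑_{k < N} ∑_{|α| = k} c_α X_α`. -/
def partialSum (X : Fin n → A) (c : FormalSeries n) (N : ℕ) : A :=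
  ∑ k ∈ Finset.range N, homPart X c k

/-- The series `∑_{k ≥ 0} ∑_{|α| = k} c_α X_α` converges in norm. -/
def ConvergesAt (X : Fin n → A) (c : FormalSeries n) : Prop :=
  ∃ L : A, Filter.Tendsto (partialSum X c) Filter.atTop (𝓝 L)

/-- The norm sum `∑_{k ≥ 0} ∑_{|α| = k} c_α X_α` (meaningful when the series converges). -/
def evalAt (X : Fin n → A) (c : FormalSeries n) : A :=
  Filter.limUnder Filter.atTop (partialSum X c)

theorem homPart_add (X : Fin n → A) (c d : FormalSeries n) (k : ℕ) :
    homPart X (c + d) k = homPart X c k + homPart X d k := by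
  simp only [homPart, FormalSeries.add_apply, add_smul, Finset.sum_add_distrib]

theorem homPart_monomial (X : Fin n → A) (α : Word n) (k : ℕ) :
    homPart X (FormalSeries.monomial α) k = if k = α.length then wordProd X α else 0 := by
  classical
  simp only [homPart, FormalSeries.monomial, ite_smul, one_smul, zero_smul,
    Finset.sum_ite_eq', mem_words]
  simp only [eq_comm]

theorem homPart_mul (X : Fin n → A) (c d : FormalSeries n) (k : ℕ) :
    homPart X (c * d) k =
      ∑ x ∈ Finset.HasAntidiagonal.antidiagonal k, homPart X c x.1 * homPart X d x.2 := by
  simp only [homPart, FormalSeries.mul_apply, Finset.sum_smul, Finset.sum_mul_sum]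
  simp only [← Finset.sum_product']
  rw [Finset.sum_sigma', Finset.sum_sigma']
  refine Finset.sum_bij' (fun x _ => ⟨(x.2.1.length, x.2.2.length), x.2⟩)
    (fun x _ => ⟨x.2.1 * x.2.2, x.2⟩) ?_ ?_ ?_ ?_ ?_
  · rintro ⟨w, u, v⟩ h
    simp only [Finset.mem_sigma, mem_splits, mem_words, Finset.HasAntidiagonal.mem_antidiagonal,
      Finset.mem_product] at h ⊢
    exact ⟨by rw [← FreeMonoid.length_mul, h.2, h.1], trivial, trivial⟩
  · rintro ⟨⟨i, j⟩, u, v⟩ h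
    simp only [Finset.mem_sigma, mem_splits, mem_words, Finset.HasAntidiagonal.mem_antidiagonal,
      Finset.mem_product] at h ⊢
    exact ⟨by rw [FreeMonoid.length_mul, h.2.1, h.2.2, h.1], trivial⟩
  · rintro ⟨w, u, v⟩ h
    simp only [Finset.mem_sigma, mem_splits] at h
    obtain ⟨-, rfl⟩ := h
    rfl
  · rintro ⟨⟨i, j⟩, u, v⟩ h
    simp only [Finset.mem_sigma, mem_words, Finset.mem_product] at h
    obtain ⟨-, rfl, rfl⟩ := h
    rfl
  · rintro ⟨w, u, v⟩ h
    simp only [Finset.mem_sigma, mem_splits] at h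
    obtain ⟨-, rfl⟩ := h
    simp only [wordProd, map_mul, smul_mul_smul_comm]

theorem wordProd_smul (s : ℂ) (X : Fin n → A) (α : Word n) :
    wordProd (s • X) α = s ^ α.length • wordProd X α := by
  induction α using FreeMonoid.inductionOn' with
  | one => simp [wordProd]
  | of_mul i w ih =>
    simp only [wordProd, map_mul, FreeMonoid.lift_eval_of, Pi.smul_apply,
      FreeMonoid.length_mul, FreeMonoid.length_of] at ih ⊢
    rw [ih, smul_mul_smul_comm, pow_add, pow_one]

theorem homPart_smul (s : ℂ) (X : Fin n → A) (c : FormalSeries n) (k : ℕ) :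
    homPart (s • X) c k = s ^ k • homPart X c k := by
  simp only [homPart, Finset.smul_sum]
  refine Finset.sum_congr rfl fun α hα => ?_
  rw [wordProd_smul, mem_words.1 hα, smul_comm]

/-- Convergence at all `s X` with `0 ≤ s < 1` is automatically absolute. -/
theorem summable_norm_homPart {X : Fin n → A} {c : FormalSeries n}
    (h : ∀ s : ℝ, 0 ≤ s → s < 1 → ConvergesAt ((s : ℂ) • X) c)
    {r : ℝ} (hr0 : 0 ≤ r) (hr1 : r < 1) :
    Summable fun k => ‖homPart ((r : ℂ) • X) c k‖ := by
  obtain ⟨s, hrs, hs1⟩ := exists_between hr1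
  have hs0 : 0 < s := hr0.trans_lt hrs
  obtain ⟨L, hL⟩ := h s hs0.le hs1
  have hterm : Filter.Tendsto (homPart ((s : ℂ) • X) c) Filter.atTop (𝓝 0) := by
    have h1 := ((Filter.tendsto_add_atTop_iff_nat 1).2 hL).sub hL
    rw [sub_self] at h1
    refine h1.congr fun k => ?_
    simp only [partialSum, Finset.sum_range_succ, add_sub_cancel_left]
  obtain ⟨M, hM⟩ := hterm.norm.bddAbove_range
  refine Summable.of_nonneg_of_le (fun _ => norm_nonneg _) (fun k => ?_)
    ((summable_geometric_of_lt_one (div_nonneg hr0 hs0.le)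
      ((div_lt_one hs0).2 hrs)).mul_right M)
  have hk : ‖homPart ((s : ℂ) • X) c k‖ ≤ M := hM ⟨k, rfl⟩
  rw [homPart_smul, norm_smul, norm_pow, Complex.norm_real, Real.norm_of_nonneg hs0.le] at hk
  rw [homPart_smul, norm_smul, norm_pow, Complex.norm_real, Real.norm_of_nonneg hr0, div_pow,
    div_mul_eq_mul_div, le_div_iff₀ (pow_pos hs0 k)]
  calc r ^ k * ‖homPart X c k‖ * s ^ k = r ^ k * (s ^ k * ‖homPart X c k‖) := by ring
    _ ≤ r ^ k * M := mul_le_mul_of_nonneg_left hk (pow_nonneg hr0 k)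

theorem convergesAt_monomial (X : Fin n → A) (α : Word n) :
    ConvergesAt X (FormalSeries.monomial α) := by
  refine ⟨wordProd X α, tendsto_atTop_of_eventually_const (i₀ := α.length + 1) fun N hN => ?_⟩
  simp only [partialSum, homPart_monomial, Finset.sum_ite_eq', Finset.mem_range]
  exact if_pos (by omega)

end Evaluation

/-! ### Positive regular polynomials and the universal model -/

/-- A positive regular noncommutative polynomial `p = ∑ a_α X_α` (finite sum): all coefficients
are nonnegative, the constant coefficient vanishes, and all `a_{g_i}` are positive. -/
structure PosRegPoly (n : ℕ) where
  poly : MonoidAlgebra ℝ (Word n)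
  nonneg : ∀ α, 0 ≤ poly.coeff α
  const_zero : poly.coeff 1 = 0
  gen_pos : ∀ i, 0 < poly.coeff (FreeMonoid.of i)

namespace PosRegPoly

variable {n : ℕ} (p : PosRegPoly n)

/-- The coefficient `a_α` of `p`. -/
def a (α : Word n) : ℝ := p.poly.coeff α

/-- The weights `b_α`: the coefficient of `X_α` in `1 + p + p² + ⋯`, that is, `b_α = 1` for the
empty word and `b_α = ∑_{j=1}^{|α|} ∑_{γ_1 ⋯ γ_j = α, |γ_i| ≥ 1} a_{γ_1} ⋯ a_{γ_j}` otherwise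
(`p^j` has no terms of degree less than `j`). -/
def b (α : Word n) : ℝ := ∑ j ∈ Finset.range (α.length + 1), (p.poly ^ j).coeff α

theorem coeff_mul_eq (x y : MonoidAlgebra ℝ (Word n)) (α : Word n) :
    (x * y).coeff α = ∑ u ∈ splits α, x.coeff u.1 * y.coeff u.2 :=
  MonoidAlgebra.coeff_mul_antidiag x y α (splits α) (by simp [mem_splits])

theorem coeff_pow_nonneg (j : ℕ) (α : Word n) : 0 ≤ (p.poly ^ j).coeff α := by
  classical
  induction j generalizing α with
  | zero =>
    rw [pow_zero, MonoidAlgebra.one_def, MonoidAlgebra.coeff_single, Finsupp.single_apply]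
    split_ifs <;> norm_num
  | succ j ih =>
    rw [pow_succ', coeff_mul_eq]
    exact Finset.sum_nonneg fun u _ => mul_nonneg (p.nonneg _) (ih _)

theorem b_nonneg (α : Word n) : 0 ≤ p.b α :=
  Finset.sum_nonneg fun j _ => p.coeff_pow_nonneg j α

theorem mul_b_le (i : Fin n) (α : Word n) :
    p.a (FreeMonoid.of i) * p.b α ≤ p.b (FreeMonoid.of i * α) := by
  have hlen : (FreeMonoid.of i * α).length = α.length + 1 := by
    rw [FreeMonoid.length_mul, FreeMonoid.length_of, add_comm]
  rw [b, b, hlen, Finset.sum_range_succ' _ (α.length + 1), Finset.mul_sum]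
  refine le_add_of_le_of_nonneg (Finset.sum_le_sum fun j _ => ?_) (p.coeff_pow_nonneg 0 _)
  rw [pow_succ', coeff_mul_eq]
  exact Finset.single_le_sum (f := fun u : Word n × Word n =>
      p.poly.coeff u.1 * (p.poly ^ j).coeff u.2)
    (fun u _ => mul_nonneg (p.nonneg _) (p.coeff_pow_nonneg j _))
    (a := (FreeMonoid.of i, α)) (mem_splits.2 rfl)

/-- The weight `√(b_α / b_{g_i α})`. -/
def weight (i : Fin n) (α : Word n) : ℝ := Real.sqrt (p.b α / p.b (FreeMonoid.of i * α))

theorem weight_sq_le (i : Fin n) (α : Word n) :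
    p.weight i α ^ 2 ≤ (p.a (FreeMonoid.of i))⁻¹ := by
  have ha : 0 < p.a (FreeMonoid.of i) := p.gen_pos i
  rw [weight, Real.sq_sqrt (div_nonneg (p.b_nonneg _) (p.b_nonneg _))]
  rcases (p.b_nonneg (FreeMonoid.of i * α)).eq_or_lt with h | h
  · rw [← h, div_zero]
    exact (inv_pos.2 ha).le
  · rw [div_le_iff₀ h, ← div_eq_inv_mul, le_div_iff₀ ha, mul_comm]
    exact p.mul_b_le i α

end PosRegPoly

/-- The full Fock space `F²(H_n)` on `n` generators, in coordinates: the Hilbert space with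
orthonormal basis `e_α`, where `α` runs over the words and `e_{g_{i_1} ⋯ g_{i_k}}` stands for
`e_{i_1} ⊗ ⋯ ⊗ e_{i_k}`. -/
abbrev Fock (n : ℕ) : Type := lp (fun _ : Word n => ℂ) 2

namespace PosRegPoly

variable {n : ℕ} (p : PosRegPoly n)

/-- The coordinates of `W_i ξ`: the value at `g_i α` is `√(b_α / b_{g_i α}) ξ_α`, and the value
at words that do not begin with `g_i` is zero. -/
def shiftFun (i : Fin n) (ξ : Word n → ℂ) : Word n → ℂ :=
  Function.extend (fun α => FreeMonoid.of i * α) (fun α => (p.weight i α : ℂ) * ξ α) 0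

theorem of_mul_injective (i : Fin n) :
    Function.Injective fun α : Word n => FreeMonoid.of i * α := fun _ _ h => mul_left_cancel h

theorem shiftFun_of_mul (i : Fin n) (ξ : Word n → ℂ) (α : Word n) :
    p.shiftFun i ξ (FreeMonoid.of i * α) = (p.weight i α : ℂ) * ξ α :=
  (of_mul_injective i).extend_apply _ _ α

theorem shiftFun_of_notMem (i : Fin n) (ξ : Word n → ℂ) {w : Word n}
    (hw : w ∉ Set.range fun α : Word n => FreeMonoid.of i * α) : p.shiftFun i ξ w = 0 :=
  Function.extend_apply' _ _ _ hw

theorem shiftFun_hasSum (i : Fin n) (ξ : Fock n) :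
    ∃ S ≤ (p.a (FreeMonoid.of i))⁻¹ * ‖ξ‖ ^ 2,
      HasSum (fun w => ‖p.shiftFun i ξ w‖ ^ 2) S := by
  have hξ : HasSum (fun α => ‖ξ α‖ ^ 2) (‖ξ‖ ^ 2) := by
    simpa using lp.hasSum_norm (p := 2) (by norm_num) ξ
  have hle : ∀ α, ‖p.shiftFun i ξ (FreeMonoid.of i * α)‖ ^ 2 ≤
      (p.a (FreeMonoid.of i))⁻¹ * ‖ξ α‖ ^ 2 := fun α => by
    rw [shiftFun_of_mul, norm_mul, mul_pow, Complex.norm_real, Real.norm_eq_abs, sq_abs]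
    exact mul_le_mul_of_nonneg_right (p.weight_sq_le i α) (sq_nonneg _)
  have hsum : Summable fun α => ‖p.shiftFun i ξ (FreeMonoid.of i * α)‖ ^ 2 :=
    Summable.of_nonneg_of_le (fun _ => sq_nonneg _) hle (hξ.summable.mul_left _)
  refine ⟨_, hasSum_le hle hsum.hasSum (hξ.mul_left _), ?_⟩
  refine ((of_mul_injective i).hasSum_iff fun w hw => ?_).1 hsum.hasSum
  rw [p.shiftFun_of_notMem i ξ hw, norm_zero]
  norm_num

theorem shiftFun_memℓp (i : Fin n) (ξ : Fock n) : Memℓp (p.shiftFun i ξ) 2 := by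
  obtain ⟨S, -, hS⟩ := p.shiftFun_hasSum i ξ
  exact memℓp_gen (by simpa using hS.summable)

theorem shiftFun_add (i : Fin n) (ξ η : Word n → ℂ) :
    p.shiftFun i (ξ + η) = p.shiftFun i ξ + p.shiftFun i η := by
  funext w
  by_cases hw : w ∈ Set.range fun α : Word n => FreeMonoid.of i * α
  · obtain ⟨α, rfl⟩ := hw
    simp only [shiftFun_of_mul, Pi.add_apply, mul_add]
  · simp only [shiftFun_of_notMem p i _ hw, Pi.add_apply, add_zero]

theorem shiftFun_smul (i : Fin n) (s : ℂ) (ξ : Word n → ℂ) :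
    p.shiftFun i (s • ξ) = s • p.shiftFun i ξ := by
  funext w
  by_cases hw : w ∈ Set.range fun α : Word n => FreeMonoid.of i * α
  · obtain ⟨α, rfl⟩ := hw
    simp only [shiftFun_of_mul, Pi.smul_apply, smul_eq_mul]
    ring
  · simp only [shiftFun_of_notMem p i _ hw, Pi.smul_apply, smul_zero]

/-- The weighted left creation operator `W_i`, with `W_i e_α = √(b_α / b_{g_i α}) e_{g_i α}`. The
tuple `(W_1, …, W_n)` is the universal model of the noncommutative domain `D_p`. -/
def W (i : Fin n) : Fock n →L[ℂ] Fock n :=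
  LinearMap.mkContinuous
    { toFun := fun ξ => ⟨p.shiftFun i ξ, p.shiftFun_memℓp i ξ⟩
      map_add' := fun ξ η => Subtype.ext (p.shiftFun_add i ξ η)
      map_smul' := fun s ξ => Subtype.ext (p.shiftFun_smul i s ξ) }
    (Real.sqrt (p.a (FreeMonoid.of i))⁻¹)
    (fun ξ => by
      obtain ⟨S, hle, hS⟩ := p.shiftFun_hasSum i ξ
      refine lp.norm_le_of_tsum_le (p := 2) (by norm_num) (by positivity) ?_
      have ha : 0 ≤ (p.a (FreeMonoid.of i))⁻¹ := inv_nonneg.2 (p.gen_pos i).le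
      have h1 : (Real.sqrt (p.a (FreeMonoid.of i))⁻¹ * ‖ξ‖) ^ 2 =
          (p.a (FreeMonoid.of i))⁻¹ * ‖ξ‖ ^ 2 := by rw [mul_pow, Real.sq_sqrt ha]
      simp only [ENNReal.toReal_ofNat, Real.rpow_ofNat]
      rw [h1]
      exact hS.tsum_eq.trans_le hle)

open Classical in
theorem W_single (i : Fin n) (α : Word n) :
    p.W i (lp.single 2 α (1 : ℂ)) =
      (p.weight i α : ℂ) • (lp.single 2 (FreeMonoid.of i * α) (1 : ℂ) : Fock n) := by
  refine Subtype.ext (funext fun w => ?_)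
  change p.shiftFun i (lp.single 2 α (1 : ℂ) : Fock n) w =
    ((p.weight i α : ℂ) • (lp.single 2 (FreeMonoid.of i * α) (1 : ℂ) : Fock n)) w
  rw [lp.coeFn_smul, Pi.smul_apply, smul_eq_mul]
  by_cases hw : w ∈ Set.range fun α : Word n => FreeMonoid.of i * α
  · obtain ⟨β, rfl⟩ := hw
    rw [shiftFun_of_mul]
    by_cases h : β = α
    · subst h; simp
    · have : FreeMonoid.of i * β ≠ FreeMonoid.of i * α := fun h' => h (mul_left_cancel h')
      simp [h, this]
  · have : w ≠ FreeMonoid.of i * α := fun h => hw ⟨α, h.symm⟩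
    rw [shiftFun_of_notMem p i _ hw]
    simp [this]

/-! ### Free holomorphic functions on the noncommutative domain -/

/-- The algebra `Hol(D_p)` of free holomorphic functions on `D_p`: the formal power series
`g = ∑ c_α Z_α` such that, for every `r ∈ [0, 1)`, the series
`g(r W_1, …, r W_n) = ∑_k ∑_{|α| = k} c_α r^{|α|} W_α` converges in the operator norm. -/
def Hol : Subalgebra ℂ (FormalSeries n) where
  carrier := {c | ∀ r : ℝ, 0 ≤ r → r < 1 → ConvergesAt ((r : ℂ) • p.W) c}
  mul_mem' := by
    intro c d hc hd r hr0 hr1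
    have hs := (summable_norm_sum_mul_antidiagonal_of_summable_norm
      (summable_norm_homPart hc hr0 hr1) (summable_norm_homPart hd hr0 hr1)).of_norm
    simp only [← homPart_mul] at hs
    exact ⟨_, hs.hasSum.tendsto_sum_nat⟩
  add_mem' := by
    intro c d hc hd r hr0 hr1
    obtain ⟨L, hL⟩ := hc r hr0 hr1
    obtain ⟨M, hM⟩ := hd r hr0 hr1
    refine ⟨L + M, (hL.add hM).congr fun N => ?_⟩
    simp only [partialSum, homPart_add, Finset.sum_add_distrib]
  algebraMap_mem' := by
    intro s r _ _
    obtain ⟨L, hL⟩ := convergesAt_monomial ((r : ℂ) • p.W) 1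
    refine ⟨s • L, (hL.const_smul s).congr fun N => ?_⟩
    rw [Algebra.algebraMap_eq_smul_one]
    simp only [partialSum, homPart, Finset.smul_sum, FormalSeries.smul_apply, mul_smul]
    rfl

/-- The indeterminate `Z_i` as an element of `Hol(D_p)`. -/
def Z (i : Fin n) : p.Hol :=
  ⟨FormalSeries.monomial (FreeMonoid.of i), fun _ _ _ => convergesAt_monomial _ _⟩

/-- `d_r(φ, ψ) = ‖φ(r W_1, …, r W_n) - ψ(r W_1, …, r W_n)‖`. -/
def d (r : ℝ) (φ ψ : p.Hol) : ℝ :=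
  ‖evalAt ((r : ℂ) • p.W) (φ : FormalSeries n) - evalAt ((r : ℂ) • p.W) (ψ : FormalSeries n)‖

/-- The metric `ρ(φ, ψ) = ∑_{m ≥ 1} 2^{-m} d_{r_m}(φ, ψ) / (1 + d_{r_m}(φ, ψ))` on `Hol(D_p)`
attached to a sequence `r_1, r_2, …` (here `r m` stands for `r_{m+1}`). -/
def rho (r : ℕ → ℝ) (φ ψ : p.Hol) : ℝ :=
  ∑' m : ℕ, (1 / 2 : ℝ) ^ (m + 1) * (p.d (r m) φ ψ / (1 + p.d (r m) φ ψ))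

/-- Continuity of a map from `(Hol(D_p), ρ)` to a normed space. -/
def RhoContinuous (r : ℕ → ℝ) {B : Type*} [NormedAddCommGroup B] (F : p.Hol → B) : Prop :=
  ∀ φ : p.Hol, ∀ ε > 0, ∃ δ > 0, ∀ ψ : p.Hol, p.rho r ψ φ < δ → ‖F ψ - F φ‖ < ε

/-! ### The joint spectral radius -/

section Radius

variable {H : Type*} [NormedAddCommGroup H] [InnerProductSpace ℂ H] [CompleteSpace H]

/-- The positive map `Φ_{p,T}(X) = ∑_{|α| ≥ 1} a_α T_α X T_α^*` (a finite sum, and the constant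
coefficient of `p` is zero). -/
def Phi (T : Fin n → H →L[ℂ] H) (X : H →L[ℂ] H) : H →L[ℂ] H :=
  ∑ α ∈ p.poly.coeff.support,
    (p.a α : ℂ) • (wordProd T α * X * ContinuousLinearMap.adjoint (wordProd T α))

/-- The joint spectral radius `r_p(T) = lim_{m → ∞} ‖Φ_{p,T}^m(I)‖^{1/(2m)}`. -/
def jointSpectralRadius (T : Fin n → H →L[ℂ] H) : ℝ :=
  Filter.limUnder Filter.atTop fun m : ℕ => ‖(p.Phi T)^[m] 1‖ ^ (1 / (2 * (m : ℝ)))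

end Radius

end PosRegPoly

end FreeHol

end

open scoped Topology

noncomputable section

namespace FreeHol

namespace PosRegPoly

variable {n : ℕ} (p : PosRegPoly n)

/-! ### Iterates of `Phi` and the joint spectral radius -/

section Radius

variable {H : Type*} [NormedAddCommGroup H] [InnerProductSpace ℂ H] [CompleteSpace H]

/-! The homogeneous parts of `g` at `T` are dominated geometrically by the norm of `g(rW)`, so one
estimate gives convergence and continuity.

On the `T` side, `‖Φ^m(1)‖` is submultiplicative, so a joint spectral radius below one makes some
iterate contractive, and by continuity this survives a dilation `sT` with `s > 1`. Hence the sums of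
`‖Φ^j(1)‖` for `sT` are bounded, and so are the rows `(√b_α s^k T_α)_{|α| = k}`, uniformly in `k`.
Cauchy–Schwarz (`norm_homPart_sq_le`) then bounds each homogeneous part by the weighted coefficient
norm `(∑ |c_α|² / b_α)^{1/2}`.

On the model side, `g(rW)` sends the vacuum to the vector with coordinates `r^|α| c_α / √b_α`, so
that coefficient norm in degree `k` is at most `‖g(rW)‖ / r^k` (`sum_coeff_sq_le`). Together the
`k`-th part at `T` is at most `C ‖g(rW)‖ (sr)^{-k}`, and a radius `r = r_m` with `s r_m > 1` makes
this summable (`exists_norm_evalAt_le`).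

Multiplicativity is the Cauchy product of absolutely convergent series. Uniqueness holds because
Taylor polynomials are `ρ`-dense and a homomorphism is determined on them by the images of the
`Z_i`. -/

/-- The action of words on operators by `X ↦ T_α X T_α^*`. -/
def conjHom (T : Fin n → H →L[ℂ] H) : Word n →* Module.End ℝ (H →L[ℂ] H) where
  toFun α := LinearMap.mulLeft ℝ (wordProd T α) ∘ₗ LinearMap.mulRight ℝ (star (wordProd T α))
  map_one' := by
    ext1 X
    simp [wordProd]
  map_mul' α β := by
    ext1 X
    simp [wordProd, mul_assoc]

theorem conjHom_apply (T : Fin n → H →L[ℂ] H) (α : Word n) (X : H →L[ℂ] H) :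
    conjHom T α X = wordProd T α * X * star (wordProd T α) := by
  simp [conjHom, mul_assoc]

theorem conjHom_nonneg (T : Fin n → H →L[ℂ] H) (α : Word n) {X : H →L[ℂ] H} (hX : 0 ≤ X) :
    0 ≤ conjHom T α X := by
  rw [conjHom_apply]
  exact star_right_conjugate_nonneg hX _

/-- The linear map underlying `Phi`. -/
def phiLinear (T : Fin n → H →L[ℂ] H) : Module.End ℝ (H →L[ℂ] H) :=
  MonoidAlgebra.lift ℝ (Module.End ℝ (H →L[ℂ] H)) (Word n) (conjHom T) p.poly

theorem Phi_eq_phiLinear (T : Fin n → H →L[ℂ] H) : p.Phi T = p.phiLinear T := by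
  funext X
  rw [phiLinear, MonoidAlgebra.lift_apply, Finsupp.sum, LinearMap.sum_apply, Phi]
  refine Finset.sum_congr rfl fun α _ => ?_
  rw [LinearMap.smul_apply, conjHom_apply, ← ContinuousLinearMap.star_eq_adjoint, Complex.coe_smul]
  rfl

/-- `phiLinear` is the image of `p` under the algebra homomorphism extending `conjHom`, so its
powers are the images of the powers of `p`; this brings in the coefficients that define `b`. -/
theorem Phi_iterate (T : Fin n → H →L[ℂ] H) (j : ℕ) (X : H →L[ℂ] H) :
    (p.Phi T)^[j] X =
      ∑ α ∈ (p.poly ^ j).coeff.support, (p.poly ^ j).coeff α • conjHom T α X := by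
  rw [Phi_eq_phiLinear, ← Module.End.pow_apply, phiLinear, ← map_pow, MonoidAlgebra.lift_apply,
    Finsupp.sum, LinearMap.sum_apply]
  rfl

theorem Phi_iterate_nonneg (T : Fin n → H →L[ℂ] H) (j : ℕ) {X : H →L[ℂ] H} (hX : 0 ≤ X) :
    0 ≤ (p.Phi T)^[j] X := by
  rw [Phi_iterate]
  exact Finset.sum_nonneg fun α _ => smul_nonneg (p.coeff_pow_nonneg j α) (conjHom_nonneg T α hX)

/-- Every term is positive, and words of `S` outside the support of `p^j` contribute zero. -/
theorem sum_conjHom_le_Phi_iterate (T : Fin n → H →L[ℂ] H) (j : ℕ) (S : Finset (Word n)) :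
    ∑ α ∈ S, (p.poly ^ j).coeff α • conjHom T α 1 ≤ (p.Phi T)^[j] 1 := by
  classical
  rw [Phi_iterate, ← Finset.sum_filter_add_sum_filter_not S
    (fun α => α ∈ (p.poly ^ j).coeff.support),
    Finset.sum_eq_zero (s := S.filter fun α => α ∉ (p.poly ^ j).coeff.support) fun α hα => ?_,
    add_zero]
  · refine Finset.sum_le_sum_of_subset_of_nonneg (fun α hα => (Finset.mem_filter.1 hα).2)
      fun α _ _ => smul_nonneg (p.coeff_pow_nonneg j α) (conjHom_nonneg T α zero_le_one)
  · rw [Finsupp.notMem_support_iff.1 (Finset.mem_filter.1 hα).2, zero_smul]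

/-- Positivity of `Φ^i` applied to `Φ^j(1) ≤ ‖Φ^j(1)‖ · 1`, followed by monotonicity of the norm on
positive elements. -/
theorem norm_Phi_iterate_add_le (T : Fin n → H →L[ℂ] H) (i j : ℕ) :
    ‖(p.Phi T)^[i + j] 1‖ ≤ ‖(p.Phi T)^[i] 1‖ * ‖(p.Phi T)^[j] 1‖ := by
  have hj := p.Phi_iterate_nonneg T j (zero_le_one (α := H →L[ℂ] H))
  have h1 : (p.Phi T)^[j] 1 ≤ ‖(p.Phi T)^[j] 1‖ • (1 : H →L[ℂ] H) := by
    rw [← Algebra.algebraMap_eq_smul_one]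
    exact IsSelfAdjoint.le_algebraMap_norm_self (.of_nonneg hj)
  have h2 : (p.Phi T)^[i + j] 1 ≤ ‖(p.Phi T)^[j] 1‖ • (p.Phi T)^[i] 1 := by
    have := p.Phi_iterate_nonneg T i (sub_nonneg.2 h1)
    rw [Phi_eq_phiLinear, ← Module.End.pow_apply, map_sub, map_smul, sub_nonneg] at this
    rwa [Function.iterate_add_apply, Phi_eq_phiLinear, ← Module.End.pow_apply,
      ← Module.End.pow_apply _ i 1]
  calc ‖(p.Phi T)^[i + j] 1‖ ≤ ‖‖(p.Phi T)^[j] 1‖ • (p.Phi T)^[i] 1‖ :=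
        CStarAlgebra.norm_le_norm_of_nonneg_of_le (p.Phi_iterate_nonneg T _ zero_le_one) h2
    _ = _ := by rw [norm_smul, norm_norm, mul_comm]

/-- If the joint spectral radius is less than one, some iterate of `Phi` is contractive at `1`. -/
theorem exists_norm_Phi_iterate_lt_one (T : Fin n → H →L[ℂ] H)
    (hT : p.jointSpectralRadius T < 1) : ∃ m, ‖(p.Phi T)^[m] 1‖ < 1 := by
  by_contra! h
  have hpos : ∀ m, 0 < ‖(p.Phi T)^[m] 1‖ := fun m => one_pos.trans_le (h m)
  have hsub : Subadditive fun m => Real.log ‖(p.Phi T)^[m] 1‖ := fun i j => by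
    rw [← Real.log_mul (hpos i).ne' (hpos j).ne']
    exact Real.log_le_log (hpos _) (p.norm_Phi_iterate_add_le T i j)
  -- Fekete's lemma; the quotients are bounded below because all the norms are assumed to be at
  -- least one.
  have hlim := hsub.tendsto_lim ⟨0, by
    rintro _ ⟨m, rfl⟩
    exact div_nonneg (Real.log_nonneg (h m)) m.cast_nonneg⟩
  have hlim' : Filter.Tendsto (fun m : ℕ => ‖(p.Phi T)^[m] 1‖ ^ (1 / (2 * (m : ℝ))))
      Filter.atTop (𝓝 (Real.exp (hsub.lim / 2))) := by
    refine ((Real.continuous_exp.tendsto _).comp (hlim.div_const 2)).congr fun m => ?_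
    rw [Real.rpow_def_of_pos (hpos m), Function.comp_apply]
    congr 1
    rw [div_div, mul_one_div, mul_comm (m : ℝ)]
  -- The limit genuinely exists here, so `limUnder` is not a default value.
  have hge : 1 ≤ p.jointSpectralRadius T := by
    rw [jointSpectralRadius, hlim'.limUnder_eq]
    exact ge_of_tendsto hlim' (.of_forall fun m => Real.one_le_rpow (h m) (by positivity))
  exact absurd hT hge.not_gt

/-- Dilating by `s` only multiplies `T_α` by `s^|α|`, so each iterate depends polynomially on `s`.
-/
theorem continuous_Phi_iterate_smul (T : Fin n → H →L[ℂ] H) (m : ℕ) :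
    Continuous fun s : ℝ => (p.Phi ((s : ℂ) • T))^[m] 1 := by
  induction m with
  | zero => exact continuous_const
  | succ m ih =>
    simp only [Function.iterate_succ_apply', Phi, wordProd_smul,
      ← ContinuousLinearMap.star_eq_adjoint]
    fun_prop

theorem exists_smul_norm_Phi_iterate_lt_one (T : Fin n → H →L[ℂ] H)
    (hT : p.jointSpectralRadius T < 1) :
    ∃ s : ℝ, 1 < s ∧ ∃ m, ‖(p.Phi ((s : ℂ) • T))^[m] 1‖ < 1 := by
  obtain ⟨m, hm⟩ := p.exists_norm_Phi_iterate_lt_one T hT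
  have hc := (p.continuous_Phi_iterate_smul T m).norm.tendsto 1
  have hev := hc.eventually_lt_const (u := 1) (by simpa using hm)
  obtain ⟨s, hs, hs1⟩ := ((hev.filter_mono nhdsWithin_le_nhds).and
    (self_mem_nhdsWithin (s := Set.Ioi (1 : ℝ)))).exists
  exact ⟨s, hs1, m, hs⟩

/-- With `u j = ‖Φ^j(1)‖` one has `u (m + j) ≤ u m * u j`, so the partial sum `S` satisfies `S ≤
∑_{j < m} u j + u m * S`, which can be solved for `S`. -/
theorem exists_sum_norm_Phi_iterate_le (T : Fin n → H →L[ℂ] H) {m : ℕ}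
    (hm : ‖(p.Phi T)^[m] 1‖ < 1) :
    ∃ C, 0 ≤ C ∧ ∀ K, ∑ j ∈ Finset.range K, ‖(p.Phi T)^[j] 1‖ ≤ C := by
  set u : ℕ → ℝ := fun j => ‖(p.Phi T)^[j] 1‖ with hu
  have hu0 : ∀ j, 0 ≤ u j := fun j => norm_nonneg _
  have h1 : 0 < 1 - u m := sub_pos.2 hm
  refine ⟨(∑ j ∈ Finset.range m, u j) / (1 - u m),
    div_nonneg (Finset.sum_nonneg fun j _ => hu0 j) h1.le, fun K => ?_⟩
  rw [le_div_iff₀ h1]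
  have hle : ∑ j ∈ Finset.range K, u j ≤ ∑ j ∈ Finset.range (m + K), u j :=
    Finset.sum_le_sum_of_subset_of_nonneg (Finset.range_mono (Nat.le_add_left K m))
      fun j _ _ => hu0 j
  have htail : ∑ j ∈ Finset.range K, u (m + j) ≤ u m * ∑ j ∈ Finset.range K, u j := by
    rw [Finset.mul_sum]
    exact Finset.sum_le_sum fun j _ => p.norm_Phi_iterate_add_le T m j
  rw [Finset.sum_range_add] at hle
  linarith

/-! ### Row estimates for homogeneous parts -/

/-- The row `(√b_α T_α)_{|α| = k}` is bounded by the partial sums of `∑ Φ^j(1)`. -/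
theorem norm_sum_b_smul_conjHom_le (T : Fin n → H →L[ℂ] H) (k : ℕ) :
    ‖∑ α ∈ words n k, p.b α • conjHom T α 1‖ ≤
      ∑ j ∈ Finset.range (k + 1), ‖(p.Phi T)^[j] 1‖ := by
  refine le_trans (CStarAlgebra.norm_le_norm_of_nonneg_of_le
    (Finset.sum_nonneg fun α _ => smul_nonneg (p.b_nonneg α) (conjHom_nonneg T α zero_le_one))
    (b := ∑ j ∈ Finset.range (k + 1), (p.Phi T)^[j] 1) ?_) (norm_sum_le _ _)
  have h : ∑ α ∈ words n k, p.b α • conjHom T α 1 =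
      ∑ j ∈ Finset.range (k + 1), ∑ α ∈ words n k, (p.poly ^ j).coeff α • conjHom T α 1 := by
    rw [Finset.sum_comm]
    refine Finset.sum_congr rfl fun α hα => ?_
    rw [b, mem_words.1 hα, Finset.sum_smul]
  rw [h]
  exact Finset.sum_le_sum fun j _ => p.sum_conjHom_le_Phi_iterate T j _

theorem b_one : p.b 1 = 1 := by
  simp [b, MonoidAlgebra.one_def]

theorem b_pos (α : Word n) : 0 < p.b α := by
  induction α using FreeMonoid.inductionOn' with
  | one => rw [b_one]; exact one_pos
  | of_mul i w ih => exact (mul_pos (p.gen_pos i) ih).trans_le (p.mul_b_le i w)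

/-- Cauchy–Schwarz for the row operator. -/
theorem norm_homPart_sq_le (T : Fin n → H →L[ℂ] H) (c : FormalSeries n) (k : ℕ) :
    ‖homPart T c k‖ ^ 2 ≤
      (∑ α ∈ words n k, ‖c α‖ ^ 2 / p.b α) * ‖∑ α ∈ words n k, p.b α • conjHom T α 1‖ := by
  set D : H →L[ℂ] H := ∑ α ∈ words n k, p.b α • conjHom T α 1 with hD
  set N : ℝ := ∑ α ∈ words n k, ‖c α‖ ^ 2 / p.b α with hN
  have hN0 : 0 ≤ N := Finset.sum_nonneg fun α _ => div_nonneg (sq_nonneg _) (p.b_nonneg α)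
  -- Passing to the adjoint turns the row into a column, whose norm at `x` is read off from the
  -- quadratic form of `D`.
  rw [← norm_star, ← Real.sqrt_le_sqrt_iff (by positivity), Real.sqrt_sq (norm_nonneg _)]
  refine ContinuousLinearMap.opNorm_le_bound _ (Real.sqrt_nonneg _) fun x => ?_
  have hx : ∑ α ∈ words n k, p.b α * ‖star (wordProd T α) x‖ ^ 2 ≤ ‖D‖ * ‖x‖ ^ 2 := by
    have h1 : ∑ α ∈ words n k, p.b α * ‖star (wordProd T α) x‖ ^ 2 = (inner ℂ x (D x)).re := by
      simp only [hD, _root_.sum_apply, inner_sum, Complex.re_sum]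
      refine Finset.sum_congr rfl fun α _ => ?_
      rw [_root_.smul_apply, conjHom_apply, mul_one, mul_apply_eq_comp,
        ← Complex.coe_smul, inner_smul_right, Complex.re_ofReal_mul,
        ← ContinuousLinearMap.adjoint_inner_left, ← ContinuousLinearMap.star_eq_adjoint]
      congr 1
      exact (inner_self_eq_norm_sq (𝕜 := ℂ) _).symm
    rw [h1]
    calc (inner ℂ x (D x)).re ≤ ‖x‖ * ‖D x‖ := re_inner_le_norm (𝕜 := ℂ) x (D x)
      _ ≤ ‖x‖ * (‖D‖ * ‖x‖) := by gcongr; exact D.le_opNorm x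
      _ = ‖D‖ * ‖x‖ ^ 2 := by ring
  have happ : ‖star (homPart T c k) x‖ ≤
      ∑ α ∈ words n k, ‖c α‖ * ‖star (wordProd T α) x‖ := by
    rw [homPart, star_sum, _root_.sum_apply]
    refine (norm_sum_le _ _).trans (Finset.sum_le_sum fun α _ => ?_)
    rw [star_smul, _root_.smul_apply, norm_smul, norm_star]
  -- Cauchy–Schwarz with `‖c α‖` split as `(‖c α‖ / √b_α) · √b_α`.
  have hcs : (∑ α ∈ words n k, ‖c α‖ * ‖star (wordProd T α) x‖) ^ 2 ≤
      N * ∑ α ∈ words n k, p.b α * ‖star (wordProd T α) x‖ ^ 2 := by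
    refine Finset.sum_sq_le_sum_mul_sum_of_sq_le_mul _
      (fun α _ => div_nonneg (sq_nonneg _) (p.b_nonneg α))
      (fun α _ => mul_nonneg (p.b_nonneg α) (sq_nonneg _)) fun α _ => ?_
    have := (p.b_pos α).ne'
    exact le_of_eq (by field_simp)
  refine le_of_sq_le_sq (a := _) ?_ (by positivity)
  rw [mul_pow, Real.sq_sqrt (by positivity)]
  calc ‖star (homPart T c k) x‖ ^ 2
      ≤ (∑ α ∈ words n k, ‖c α‖ * ‖star (wordProd T α) x‖) ^ 2 := by gcongr
    _ ≤ N * (‖D‖ * ‖x‖ ^ 2) := hcs.trans (by gcongr)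
    _ = N * ‖D‖ * ‖x‖ ^ 2 := by ring

end Radius

end PosRegPoly

/-! ### Algebraic properties of evaluation -/

section Evaluation

variable {n : ℕ} {A : Type*} [NormedRing A] [NormedAlgebra ℂ A]

theorem ConvergesAt.tendsto {X : Fin n → A} {c : FormalSeries n} (h : ConvergesAt X c) :
    Filter.Tendsto (partialSum X c) Filter.atTop (𝓝 (evalAt X c)) :=
  tendsto_nhds_limUnder h

theorem evalAt_eq_of_tendsto {X : Fin n → A} {c : FormalSeries n} {L : A}
    (h : Filter.Tendsto (partialSum X c) Filter.atTop (𝓝 L)) : evalAt X c = L :=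
  h.limUnder_eq

theorem evalAt_add {X : Fin n → A} {c d : FormalSeries n} (hc : ConvergesAt X c)
    (hd : ConvergesAt X d) : evalAt X (c + d) = evalAt X c + evalAt X d :=
  evalAt_eq_of_tendsto <| (hc.tendsto.add hd.tendsto).congr fun N => by
    simp only [partialSum, homPart_add, Finset.sum_add_distrib]

theorem homPart_const_smul (X : Fin n → A) (a : ℂ) (c : FormalSeries n) (k : ℕ) :
    homPart X (a • c) k = a • homPart X c k := by
  simp only [homPart, FormalSeries.smul_apply, mul_smul, Finset.smul_sum]

theorem evalAt_const_smul {X : Fin n → A} (a : ℂ) {c : FormalSeries n} (hc : ConvergesAt X c) :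
    evalAt X (a • c) = a • evalAt X c :=
  evalAt_eq_of_tendsto <| (hc.tendsto.const_smul a).congr fun N => by
    simp only [partialSum, homPart_const_smul, Finset.smul_sum]

theorem evalAt_sub {X : Fin n → A} {c d : FormalSeries n} (hc : ConvergesAt X c)
    (hd : ConvergesAt X d) : evalAt X (c - d) = evalAt X c - evalAt X d :=
  evalAt_eq_of_tendsto <| (hc.tendsto.sub hd.tendsto).congr fun N => by
    have h : ∀ k, homPart X (c - d) k = homPart X c k - homPart X d k := fun k => by
      rw [eq_sub_iff_add_eq, ← homPart_add, sub_add_cancel]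
    simp only [partialSum, h, Finset.sum_sub_distrib]

theorem evalAt_monomial (X : Fin n → A) (α : Word n) :
    evalAt X (FormalSeries.monomial α) = wordProd X α :=
  evalAt_eq_of_tendsto <| tendsto_atTop_of_eventually_const (i₀ := α.length + 1) fun N hN => by
    simp only [partialSum, homPart_monomial, Finset.sum_ite_eq', Finset.mem_range]
    exact if_pos (by omega)

theorem evalAt_one (X : Fin n → A) : evalAt X (1 : FormalSeries n) = 1 :=
  (evalAt_monomial X 1).trans (map_one _)

theorem hasSum_homPart [CompleteSpace A] {X : Fin n → A} {c : FormalSeries n}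
    (h : Summable fun k => ‖homPart X c k‖) : HasSum (homPart X c) (evalAt X c) := by
  rw [evalAt_eq_of_tendsto h.of_norm.hasSum.tendsto_sum_nat]
  exact h.of_norm.hasSum

/-- The homogeneous parts of `c * d` are the Cauchy products of those of the factors, and absolute
summability permits the rearrangement. -/
theorem evalAt_mul [CompleteSpace A] {X : Fin n → A} {c d : FormalSeries n}
    (hc : Summable fun k => ‖homPart X c k‖) (hd : Summable fun k => ‖homPart X d k‖) :
    evalAt X (c * d) = evalAt X c * evalAt X d := by
  have hs := summable_norm_sum_mul_antidiagonal_of_summable_norm hc hd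
  have h := tsum_mul_tsum_eq_tsum_sum_antidiagonal_of_summable_norm hc hd
  simp only [← homPart_mul] at hs h
  rw [← (hasSum_homPart hs).tsum_eq, ← h, (hasSum_homPart hc).tsum_eq, (hasSum_homPart hd).tsum_eq]

end Evaluation

/-! ### Coefficients read from the vacuum vector -/

namespace PosRegPoly

variable {n : ℕ} (p : PosRegPoly n)

-- The weights `√(b_w / b_{g_i w})` telescope along the word, from `b_1 = 1` to `b_α`.
open Classical in
theorem wordProd_W_vacuum (α : Word n) :
    wordProd p.W α (lp.single 2 1 (1 : ℂ)) =
      (((Real.sqrt (p.b α))⁻¹ : ℝ) : ℂ) • (lp.single 2 α (1 : ℂ) : Fock n) := by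
  induction α using FreeMonoid.inductionOn' with
  | one => simp [wordProd, b_one]
  | of_mul i w ih =>
    have hw : Real.sqrt (p.b w) ≠ 0 := (Real.sqrt_pos.2 (p.b_pos w)).ne'
    simp only [wordProd, map_mul, FreeMonoid.lift_eval_of] at ih ⊢
    rw [mul_apply_eq_comp, ih, map_smul, W_single, smul_smul,
      ← Complex.ofReal_mul, weight, Real.sqrt_div (p.b_nonneg w), inv_mul_eq_div,
      div_div_cancel_left' hw]

open Classical in
theorem partialSum_W_vacuum_apply (r : ℝ) (c : FormalSeries n) (β : Word n) {N : ℕ}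
    (hN : β.length < N) :
    partialSum ((r : ℂ) • p.W) c N (lp.single 2 1 (1 : ℂ)) β =
      (r : ℂ) ^ β.length * c β * ((Real.sqrt (p.b β))⁻¹ : ℝ) := by
  have h : ∀ k, (homPart ((r : ℂ) • p.W) c k (lp.single 2 1 (1 : ℂ)) : Fock n) β =
      if k = β.length then (r : ℂ) ^ β.length * c β * ((Real.sqrt (p.b β))⁻¹ : ℝ) else 0 := by
    intro k
    rw [homPart, _root_.sum_apply, lp.coeFn_sum, Finset.sum_apply]
    simp only [_root_.smul_apply, wordProd_smul, wordProd_W_vacuum, lp.coeFn_smul, Pi.smul_apply,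
      lp.single_apply, smul_eq_mul, Pi.single_apply, mul_ite, mul_zero, mul_one,
      Finset.sum_ite_eq, mem_words]
    simp only [eq_comm (a := k)]
    refine if_congr Iff.rfl ?_ rfl
    ring
  rw [partialSum, _root_.sum_apply, lp.coeFn_sum, Finset.sum_apply]
  simp only [h, Finset.sum_ite_eq', Finset.mem_range, hN, if_true]

open Classical in
theorem evalAt_W_vacuum_apply (r : ℝ) {c : FormalSeries n} (hc : ConvergesAt ((r : ℂ) • p.W) c)
    (β : Word n) : evalAt ((r : ℂ) • p.W) c (lp.single 2 1 (1 : ℂ)) β =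
      (r : ℂ) ^ β.length * c β * ((Real.sqrt (p.b β))⁻¹ : ℝ) := by
  have h1 : Filter.Tendsto (fun N => (partialSum ((r : ℂ) • p.W) c N (lp.single 2 1 (1 : ℂ))) β)
      Filter.atTop (𝓝 (evalAt ((r : ℂ) • p.W) c (lp.single 2 1 (1 : ℂ)) β)) :=
    ((lp.evalCLM ℂ (fun _ : Word n => ℂ) 2 β).continuous.tendsto _).comp
      (((ContinuousLinearMap.apply ℂ (Fock n) (lp.single 2 1 (1 : ℂ) : Fock n)).continuous.tendsto
        _).comp hc.tendsto)
  -- Only degree `|β|` contributes to the coordinate `β`, so the coordinates of the partial sums are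
  -- eventually constant.
  refine tendsto_nhds_unique h1 (tendsto_atTop_of_eventually_const (i₀ := β.length + 1)
    fun N hN => p.partialSum_W_vacuum_apply r c β hN)

/-- The homogeneous coefficients are controlled by the norm of `g(r W_1, …, r W_n)`. -/
theorem sum_coeff_sq_le {r : ℝ} (hr : 0 < r) {c : FormalSeries n}
    (hc : ConvergesAt ((r : ℂ) • p.W) c) (k : ℕ) :
    ∑ α ∈ words n k, ‖c α‖ ^ 2 / p.b α ≤ (‖evalAt ((r : ℂ) • p.W) c‖ / r ^ k) ^ 2 := by
  classical
  set F := evalAt ((r : ℂ) • p.W) c with hF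
  have h1 := lp.sum_rpow_le_norm_rpow (p := 2) (by norm_num)
    (F (lp.single 2 1 (1 : ℂ)) : Fock n) (words n k)
  simp only [ENNReal.toReal_ofNat, Real.rpow_ofNat] at h1
  have h2 : ‖(F (lp.single 2 1 (1 : ℂ)) : Fock n)‖ ≤ ‖F‖ := by
    refine (F.le_opNorm _).trans_eq ?_
    rw [lp.norm_single (by norm_num), norm_one, mul_one]
  have h3 : ∑ α ∈ words n k, ‖(F (lp.single 2 1 (1 : ℂ)) : Fock n) α‖ ^ 2 =
      (r ^ k) ^ 2 * ∑ α ∈ words n k, ‖c α‖ ^ 2 / p.b α := by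
    rw [Finset.mul_sum]
    refine Finset.sum_congr rfl fun α hα => ?_
    rw [hF, p.evalAt_W_vacuum_apply r hc, norm_mul, norm_mul, norm_pow, Complex.norm_real,
      Complex.norm_real, Real.norm_of_nonneg hr.le, mem_words.1 hα, mul_pow, mul_pow,
      Real.norm_of_nonneg (by positivity), inv_pow, Real.sq_sqrt (p.b_nonneg α), mul_assoc,
      div_eq_mul_inv]
  rw [h3] at h1
  rw [div_pow, le_div_iff₀ (by positivity), mul_comm]
  exact h1.trans (by gcongr)

/-! ### The metric `ρ` -/

theorem d_eq {r : ℝ} (hr0 : 0 ≤ r) (hr1 : r < 1) (φ ψ : p.Hol) :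
    p.d r φ ψ = ‖evalAt ((r : ℂ) • p.W) ((φ - ψ : p.Hol) : FormalSeries n)‖ := by
  rw [d, Subalgebra.coe_sub, evalAt_sub (φ.2 r hr0 hr1) (ψ.2 r hr0 hr1)]

theorem d_nonneg (r : ℝ) (φ ψ : p.Hol) : 0 ≤ p.d r φ ψ := norm_nonneg _

theorem rho_term_nonneg (r : ℕ → ℝ) (φ ψ : p.Hol) (m : ℕ) :
    0 ≤ (1 / 2 : ℝ) ^ (m + 1) * (p.d (r m) φ ψ / (1 + p.d (r m) φ ψ)) := by
  have := p.d_nonneg (r m) φ ψ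
  positivity

theorem rho_term_le (r : ℕ → ℝ) (φ ψ : p.Hol) (m : ℕ) :
    (1 / 2 : ℝ) ^ (m + 1) * (p.d (r m) φ ψ / (1 + p.d (r m) φ ψ)) ≤ (1 / 2 : ℝ) ^ (m + 1) := by
  have := p.d_nonneg (r m) φ ψ
  exact mul_le_of_le_one_right (by positivity) ((div_le_one (by positivity)).2 (by linarith))

theorem summable_half_pow_succ : Summable fun m : ℕ => (1 / 2 : ℝ) ^ (m + 1) :=
  (summable_nat_add_iff 1).2 summable_geometric_two

theorem rho_term_le_rho (r : ℕ → ℝ) (φ ψ : p.Hol) (m : ℕ) :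
    (1 / 2 : ℝ) ^ (m + 1) * (p.d (r m) φ ψ / (1 + p.d (r m) φ ψ)) ≤ p.rho r φ ψ :=
  (Summable.of_nonneg_of_le (p.rho_term_nonneg r φ ψ) (p.rho_term_le r φ ψ)
    summable_half_pow_succ).le_tsum m fun j _ => p.rho_term_nonneg r φ ψ j

/-- A small `ρ`-distance forces a small `d_{r_m}`-distance. -/
theorem exists_d_lt_of_rho_lt (r : ℕ → ℝ) (m : ℕ) {e : ℝ} (he : 0 < e) :
    ∃ δ > 0, ∀ φ ψ : p.Hol, p.rho r φ ψ < δ → p.d (r m) φ ψ < e := by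
  -- This is the `m`-th term of `ρ` at distance `e`; since `t / (1 + t)` is increasing, a smaller
  -- `ρ` forces `d < e`.
  refine ⟨(1 / 2 : ℝ) ^ (m + 1) * (e / (1 + e)), by positivity, fun φ ψ h => ?_⟩
  have h1 := lt_of_mul_lt_mul_left ((p.rho_term_le_rho r φ ψ m).trans_lt h) (by positivity)
  have hd := p.d_nonneg (r m) φ ψ
  rw [div_lt_div_iff₀ (by positivity) (by positivity)] at h1
  linarith

/-- Dominated convergence for series, with the terms bounded by `2^{-(m+1)}`. -/
theorem rho_tendsto_zero {r : ℕ → ℝ} {φ : ℕ → p.Hol} {ψ : p.Hol}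
    (h : ∀ m, Filter.Tendsto (fun N => p.d (r m) (φ N) ψ) Filter.atTop (𝓝 0)) :
    Filter.Tendsto (fun N => p.rho r (φ N) ψ) Filter.atTop (𝓝 0) := by
  have := tendsto_tsum_of_dominated_convergence (𝓕 := Filter.atTop)
    (f := fun N m => (1 / 2 : ℝ) ^ (m + 1) * (p.d (r m) (φ N) ψ / (1 + p.d (r m) (φ N) ψ)))
    (g := fun _ => 0) summable_half_pow_succ (fun m => by
      simpa using (((h m).div ((h m).const_add 1) (by norm_num)).const_mul ((1 / 2 : ℝ) ^ (m + 1))))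
    (.of_forall fun N m => by
      rw [Real.norm_of_nonneg (p.rho_term_nonneg r _ _ m)]
      exact p.rho_term_le r _ _ m)
  rwa [tsum_zero] at this

/-! ### Taylor polynomials and uniqueness -/

/-- The monomial `Z_α` as an element of `Hol(D_p)`. -/
def holMonomial (α : Word n) : p.Hol :=
  ⟨FormalSeries.monomial α, fun _ _ _ => convergesAt_monomial _ _⟩

theorem monomial_mul (α β : Word n) :
    FormalSeries.monomial α * FormalSeries.monomial β = FormalSeries.monomial (α * β) := by
  classical
  funext w
  rw [FormalSeries.mul_apply]
  have h : ∀ x : Word n × Word n, FormalSeries.monomial α x.1 * FormalSeries.monomial β x.2 =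
      if x = (α, β) then 1 else 0 := fun x => by
    simp only [FormalSeries.monomial, ite_mul, one_mul, zero_mul, ← ite_and, Prod.ext_iff]
  simp only [h, Finset.sum_ite_eq', mem_splits]
  exact if_congr eq_comm rfl rfl

theorem holMonomial_eq_wordProd (α : Word n) : p.holMonomial α = FreeMonoid.lift p.Z α := by
  induction α using FreeMonoid.inductionOn' with
  | one => rfl
  | of_mul i w ih =>
    rw [map_mul, ← ih, FreeMonoid.lift_eval_of]
    exact Subtype.ext (monomial_mul _ _).symm

/-- The Taylor polynomial of degree less than `N`. -/
def truncation (g : p.Hol) (N : ℕ) : p.Hol :=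
  ∑ k ∈ Finset.range N, ∑ α ∈ words n k, (g : FormalSeries n) α • p.holMonomial α

theorem map_truncation {B : Type*} [NormedRing B] [NormedAlgebra ℂ B] (Φ : p.Hol →ₐ[ℂ] B)
    (g : p.Hol) (N : ℕ) : Φ (p.truncation g N) = partialSum (fun i => Φ (p.Z i)) g N := by
  simp only [truncation, partialSum, homPart, map_sum, map_smul, holMonomial_eq_wordProd, wordProd]
  refine Finset.sum_congr rfl fun k _ => Finset.sum_congr rfl fun α _ => ?_
  congr 1
  exact DFunLike.congr_fun (FreeMonoid.comp_lift (Φ : p.Hol →* B) p.Z) α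

/-- Evaluation at an absolutely summable tuple, as an algebra homomorphism. -/
def evalHom {B : Type*} [NormedRing B] [NormedAlgebra ℂ B] [CompleteSpace B] (X : Fin n → B)
    (hX : ∀ g : p.Hol, Summable fun k => ‖homPart X (g : FormalSeries n) k‖) : p.Hol →ₐ[ℂ] B :=
  AlgHom.ofLinearMap
    { toFun := fun g => evalAt X (g : FormalSeries n)
      map_add' := fun g h => evalAt_add ⟨_, (hasSum_homPart (hX g)).tendsto_sum_nat⟩
        ⟨_, (hasSum_homPart (hX h)).tendsto_sum_nat⟩
      map_smul' := fun a g => evalAt_const_smul a ⟨_, (hasSum_homPart (hX g)).tendsto_sum_nat⟩ }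
    (evalAt_one X) fun g h => evalAt_mul (hX g) (hX h)

theorem evalHom_Z {B : Type*} [NormedRing B] [NormedAlgebra ℂ B] [CompleteSpace B] (X : Fin n → B)
    (hX : ∀ g : p.Hol, Summable fun k => ‖homPart X (g : FormalSeries n) k‖) (i : Fin n) :
    p.evalHom X hX (p.Z i) = X i :=
  (evalAt_monomial X _).trans (FreeMonoid.lift_eval_of X i)

theorem truncation_rho_tendsto {r : ℕ → ℝ} (hr : ∀ m, 0 < r m ∧ r m < 1) (g : p.Hol) :
    Filter.Tendsto (fun N => p.rho r (p.truncation g N) g) Filter.atTop (𝓝 0) := by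
  refine p.rho_tendsto_zero fun m => ?_
  have hX : ∀ g : p.Hol, Summable fun k => ‖homPart ((r m : ℂ) • p.W) (g : FormalSeries n) k‖ :=
    fun g => summable_norm_homPart g.2 (hr m).1.le (hr m).2
  have h := tendsto_iff_norm_sub_tendsto_zero.1
    (ConvergesAt.tendsto (g.2 (r m) (hr m).1.le (hr m).2))
  refine h.congr fun N => ?_
  -- Evaluation at `r_m W` is itself a homomorphism, so it sends the Taylor polynomial to the
  -- partial sum of `g(r_m W)`.
  have h2 := p.map_truncation (p.evalHom _ hX) g N
  simp only [evalHom_Z] at h2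
  rw [← h2]
  rfl

/-- A `ρ`-continuous homomorphism is determined by its values at the indeterminates. -/
theorem eq_of_rhoContinuous {B : Type*} [NormedRing B] [NormedAlgebra ℂ B] {r : ℕ → ℝ}
    (hr : ∀ m, 0 < r m ∧ r m < 1) {Φ Ψ : p.Hol →ₐ[ℂ] B} (hΦ : p.RhoContinuous r Φ)
    (hΨ : p.RhoContinuous r Ψ) (h : ∀ i, Φ (p.Z i) = Ψ (p.Z i)) : Φ = Ψ := by
  have key : ∀ (Θ : p.Hol →ₐ[ℂ] B), p.RhoContinuous r Θ → ∀ g, Filter.Tendsto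
      (fun N => Θ (p.truncation g N)) Filter.atTop (𝓝 (Θ g)) := fun Θ hΘ g => by
    refine Metric.tendsto_nhds.2 fun ε hε => ?_
    obtain ⟨δ, hδ, hlt⟩ := hΘ g ε hε
    filter_upwards [(p.truncation_rho_tendsto hr g).eventually_lt_const hδ] with N hN
    rw [dist_eq_norm]
    exact hlt _ hN
  refine AlgHom.ext fun g => tendsto_nhds_unique (key Φ hΦ g) ((key Ψ hΨ g).congr fun N => ?_)
  rw [map_truncation, map_truncation, funext h]

/-! ### Comparison of `T` with the universal model -/

section Radius

variable {H : Type*} [NormedAddCommGroup H] [InnerProductSpace ℂ H] [CompleteSpace H]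

/-- Geometric domination of the homogeneous parts at `T` by the universal model. -/
theorem exists_norm_homPart_le (T : Fin n → H →L[ℂ] H) (hT : p.jointSpectralRadius T < 1) :
    ∃ s > 1, ∃ C ≥ 0, ∀ r : ℝ, 0 < r → ∀ c : FormalSeries n, ConvergesAt ((r : ℂ) • p.W) c →
      ∀ k, ‖homPart T c k‖ ≤ C * ‖evalAt ((r : ℂ) • p.W) c‖ * ((s * r)⁻¹) ^ k := by
  obtain ⟨s, hs, m, hm⟩ := p.exists_smul_norm_Phi_iterate_lt_one T hT
  obtain ⟨C, hC0, hC⟩ := p.exists_sum_norm_Phi_iterate_le _ hm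
  have hs0 : 0 < s := one_pos.trans hs
  refine ⟨s, hs, Real.sqrt C, Real.sqrt_nonneg C, fun r hr c hc k => ?_⟩
  -- The row estimate is used at `sT`; homogeneity then yields the gain `s^{-k}` at `T`.
  have h1 : ‖homPart ((s : ℂ) • T) c k‖ ^ 2 ≤ (‖evalAt ((r : ℂ) • p.W) c‖ / r ^ k) ^ 2 * C :=
    (p.norm_homPart_sq_le _ c k).trans (mul_le_mul (p.sum_coeff_sq_le hr hc k)
      ((p.norm_sum_b_smul_conjHom_le _ k).trans (hC _)) (norm_nonneg _) (sq_nonneg _))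
  have h2 := Real.le_sqrt_of_sq_le h1
  rw [Real.sqrt_mul (sq_nonneg _), Real.sqrt_sq (by positivity), homPart_smul, norm_smul, norm_pow,
    Complex.norm_real, Real.norm_of_nonneg hs0.le, mul_comm (s ^ k),
    ← le_div_iff₀ (by positivity)] at h2
  refine h2.trans_eq ?_
  rw [inv_pow, mul_pow]
  field_simp

/-- A uniform bound of `g(T)` by the norm of `g(r W)` for some radius of the given sequence. -/
theorem exists_norm_evalAt_le (T : Fin n → H →L[ℂ] H) (hT : p.jointSpectralRadius T < 1)
    {r : ℕ → ℝ} (hr : ∀ m, 0 < r m ∧ r m < 1) (hr_lim : Filter.Tendsto r Filter.atTop (𝓝 1)) :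
    (∀ g : p.Hol, Summable fun k => ‖homPart T (g : FormalSeries n) k‖) ∧
    ∃ m, ∃ K > 0, ∀ g : p.Hol, ‖evalAt T (g : FormalSeries n)‖ ≤
      K * ‖evalAt ((r m : ℂ) • p.W) (g : FormalSeries n)‖ := by
  obtain ⟨s, hs, C, hC0, hC⟩ := p.exists_norm_homPart_le T hT
  -- As `r_m → 1` and `s > 1`, some radius has `s r_m > 1`, so the geometric ratio is below one.
  obtain ⟨m, hm⟩ := ((hr_lim.const_mul s).eventually_const_lt (by rwa [mul_one])).exists
  have hq0 : 0 ≤ (s * r m)⁻¹ := inv_nonneg.2 (one_pos.trans hm).le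
  have hq1 : (s * r m)⁻¹ < 1 := inv_lt_one_of_one_lt₀ hm
  have hgeo := summable_geometric_of_lt_one hq0 hq1
  have hle : ∀ g : p.Hol, ∀ k, ‖homPart T (g : FormalSeries n) k‖ ≤
      C * ‖evalAt ((r m : ℂ) • p.W) (g : FormalSeries n)‖ * ((s * r m)⁻¹) ^ k :=
    fun g => hC _ (hr m).1 _ (g.2 _ (hr m).1.le (hr m).2)
  have hsum : ∀ g : p.Hol, Summable fun k => ‖homPart T (g : FormalSeries n) k‖ := fun g =>
    Summable.of_nonneg_of_le (fun _ => norm_nonneg _) (hle g) (hgeo.mul_left _)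
  have hq2 : 0 < 1 - (s * r m)⁻¹ := sub_pos.2 hq1
  -- The summand `1` keeps the constant strictly positive even when `C = 0`.
  refine ⟨hsum, m, C * (1 - (s * r m)⁻¹)⁻¹ + 1, by positivity, fun g => ?_⟩
  rw [← (hasSum_homPart (hsum g)).tsum_eq]
  have h := tsum_of_norm_bounded ((hasSum_geometric_of_lt_one hq0 hq1).mul_left
    (C * ‖evalAt ((r m : ℂ) • p.W) (g : FormalSeries n)‖)) (hle g)
  have := norm_nonneg (evalAt ((r m : ℂ) • p.W) (g : FormalSeries n))
  linarith

end Radius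

end PosRegPoly

end FreeHol

end

theorem mainTheorem8 {n : ℕ} (hn : 1 ≤ n) (p : FreeHol.PosRegPoly n)
    {H : Type*} [NormedAddCommGroup H] [InnerProductSpace ℂ H] [CompleteSpace H]
    (T : Fin n → H →L[ℂ] H) (hT : p.jointSpectralRadius T < 1)
    (r : ℕ → ℝ) (hr : ∀ m, 0 < r m ∧ r m < 1) (hr_mono : Monotone r)
    (hr_lim : Filter.Tendsto r Filter.atTop (nhds 1)) :
    (∀ g : p.Hol, FreeHol.ConvergesAt T (g : FreeHol.FormalSeries n)) ∧
    ∃ Ψ : p.Hol →ₐ[ℂ] (H →L[ℂ] H),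
      (∀ g : p.Hol, Ψ g = FreeHol.evalAt T (g : FreeHol.FormalSeries n)) ∧
      p.RhoContinuous r Ψ ∧
      (∀ i, Ψ (p.Z i) = T i) ∧
      ∀ Φ : p.Hol →ₐ[ℂ] (H →L[ℂ] H),
        p.RhoContinuous r Φ → (∀ i, Φ (p.Z i) = T i) → Φ = Ψ := by
  obtain ⟨hsum, m, K, hK, hle⟩ := p.exists_norm_evalAt_le T hT hr hr_lim
  have hcont : p.RhoContinuous r (p.evalHom T hsum) := fun φ ε hε => by
    -- By linearity the bound applies to `ψ - φ`, so it suffices to make `d_{r_m}` smaller than `ε /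
    -- K`.
    obtain ⟨δ, hδ, hlt⟩ := p.exists_d_lt_of_rho_lt r m (div_pos hε hK)
    refine ⟨δ, hδ, fun ψ h => ?_⟩
    rw [← map_sub]
    refine (hle (ψ - φ)).trans_lt ?_
    rw [← p.d_eq (hr m).1.le (hr m).2, ← lt_div_iff₀' hK]
    exact hlt ψ φ h
  exact ⟨fun g => ⟨_, (FreeHol.hasSum_homPart (hsum g)).tendsto_sum_nat⟩, p.evalHom T hsum,
    fun _ => rfl, hcont, p.evalHom_Z T hsum, fun Φ hΦ hZ =>
      p.eq_of_rhoContinuous hr hΦ hcont fun i => (hZ i).trans (p.evalHom_Z T hsum i).symm⟩
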